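/- Let $T\in(0,\infty)$, let $(\Omega,\mathcal F,\mathbb P)$ be a probability space, $(K,\mathcal K)$ a measurable space with a distinguished point $\Delta\in K$, and let $(S_n,X_n)_{n\ge1}$ be a non-explosive marked point process on $[0,T]\times K$: $S_n$ and $X_n$ are random variables with values in $(0,T]\cup\{\infty\}$ and $K$ respectively; with $S_0=0$, one has $S_n\le S_{n+1}$ everywhere and $X_n=\Delta$ on $\{S_n=\infty\}$; almost surely $S_1>0$ and, for all $n$, $S_n<S_{n+1}$ whenever $S_n\le T$; and $\Omega=\bigcup_n\{S_n>T\}$. Let $(\mathcal F_t)_{t\ge0}$ be the filtration generated by the point process, i.e. the smallest filtration for which each $S_n$ is a stopping time and each $X_n$ is $\mathcal F_{S_n}$-measurable. Let $A$ be the $(\mathcal F_t)$-predictable compensator of $N_t=\sum_{n\ge1}1_{\{S_n\le t\}}$, that is, the predictable nondecreasing càdlàg process with $A_0=0$ such that $\mathbb E\int_0^\infty H_t\,dN_t=\mathbb E\int_0^\infty H_t\,dA_t$ for every nonnegative predictable process $H$. Assume $(\mathbf{A_1})$: the process $A$ is continuous. Then, for every $n\ge0$, the inequality $\mathbb E\big[e^{A_{T\wedge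 S_{n+1}}}\big]<\infty$ implies $$\mathbb P(S_{n+1}>T\mid\mathcal F_{S_n})>0\quad\text{a.s.}\qquad(*)$$ In particular, if $\mathbb E\big[e^{\beta A_T}\big]<\infty$ for some real $\beta\ge1$, then $(*)$ holds for every $n\ge0$ (this is assumption $(\mathbf{A_2})$). -/

import Mathlib

open MeasureTheory ProbabilityTheory
open scoped NNReal ENNReal

noncomputable section

/-- A non-explosive multivariate (marked) point process on `[0, T] × K`, defined on the
probability space `(Ω, P)`: jump times `S n`, `n ≥ 1`, with values in `(0, T] ∪ {∞}`, and marks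
`X n` in `K`, with the convention `S 0 = 0`. The mark is the distinguished point `Δ` when the
corresponding time is infinite. -/
structure MarkedPointProcess {Ω : Type*} [MeasurableSpace Ω] (P : Measure Ω)
    (K : Type*) [MeasurableSpace K] (T : ℝ≥0) where
  S : ℕ → Ω → WithTop ℝ≥0
  X : ℕ → Ω → K
  Δ : K
  measurable_S : ∀ n, Measurable (S n)
  measurable_X : ∀ n, Measurable (X n)
  S_zero : ∀ ω, S 0 ω = 0
  X_zero : ∀ ω, X 0 ω = Δ
  S_le_or_top : ∀ n ω, S n ω ≤ T ∨ S n ω = ⊤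
  X_of_top : ∀ n ω, S n ω = ⊤ → X n ω = Δ
  S_one_pos : ∀ᵐ ω ∂P, 0 < S 1 ω
  S_mono : ∀ n ω, S n ω ≤ S (n + 1) ω
  S_strict : ∀ᵐ ω ∂P, ∀ n, S n ω ≤ T → S n ω < S (n + 1) ω
  nonexplosive : ∀ ω, ∃ n, T < S n ω

namespace MarkedPointProcess

variable {Ω : Type*} [mΩ : MeasurableSpace Ω] {P : Measure Ω} {K : Type*} [MeasurableSpace K]
  {T : ℝ≥0}

/-- The filtration generated by the marked point process: `𝓕 t` is generated by the events
`{S n ≤ s, X n ∈ B}` with `n ≥ 1`, `s ≤ t` and `B ⊆ K` measurable. By `isLeast_filtration` below it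
is the smallest filtration for which each `S n` is a stopping time and `X n` is
`𝓕_{S n}`-measurable. -/
def filtration (M : MarkedPointProcess P K T) : Filtration ℝ≥0 mΩ where
  seq t := MeasurableSpace.generateFrom
    {E | ∃ n : ℕ, 1 ≤ n ∧ ∃ s : ℝ≥0, s ≤ t ∧ ∃ B : Set K, MeasurableSet B ∧
      E = M.X n ⁻¹' B ∩ {ω | M.S n ω ≤ s}}
  mono' := by
    intro t t' h
    apply MeasurableSpace.generateFrom_mono
    rintro E ⟨n, hn, s, hs, B, hB, rfl⟩
    exact ⟨n, hn, s, hs.trans h, B, hB, rfl⟩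
  le' := by
    intro t
    apply MeasurableSpace.generateFrom_le
    rintro E ⟨n, hn, s, hs, B, hB, rfl⟩
    exact (M.measurable_X n hB).inter (M.measurable_S n measurableSet_Iic)

/-- Every `S n`, `n ≥ 0`, is a stopping time of the generated filtration. -/
theorem isStoppingTime (M : MarkedPointProcess P K T) (n : ℕ) :
    IsStoppingTime M.filtration (M.S n) := by
  intro t
  rcases Nat.eq_zero_or_pos n with rfl | hn
  · simp [M.S_zero]
  · exact MeasurableSpace.measurableSet_generateFrom
      ⟨n, hn, t, le_rfl, Set.univ, MeasurableSet.univ, by simp⟩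

/-- Every mark `X n` is `𝓕_{S n}`-measurable. -/
theorem measurable_mark (M : MarkedPointProcess P K T) (n : ℕ) :
    Measurable[(M.isStoppingTime n).measurableSpace] (M.X n) := by
  rcases Nat.eq_zero_or_pos n with rfl | hn
  · have : M.X 0 = fun _ => M.Δ := funext M.X_zero
    rw [this]
    exact measurable_const
  intro B hB
  have key : ∀ t : ℝ≥0, MeasurableSet[M.filtration t] (M.X n ⁻¹' B ∩ {ω | M.S n ω ≤ t}) :=
    fun t => MeasurableSpace.measurableSet_generateFrom ⟨n, hn, t, le_rfl, B, hB, rfl⟩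
  refine ⟨?_, key⟩
  have h1 := le_iSup M.filtration.seq T _ (key T)
  have h2 := (le_iSup M.filtration.seq T _ (M.isStoppingTime n T)).compl
  have hX : ∀ ω, ¬ M.S n ω ≤ T → M.X n ω = M.Δ :=
    fun ω h => M.X_of_top n ω ((M.S_le_or_top n ω).resolve_left h)
  by_cases hΔ : M.Δ ∈ B
  · convert h1.union h2 using 1
    ext ω
    change M.X n ω ∈ B ↔ (M.X n ω ∈ B ∧ M.S n ω ≤ T) ∨ ¬ M.S n ω ≤ T
    have : ¬ M.S n ω ≤ T → M.X n ω ∈ B := fun h => by rwa [hX ω h]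
    tauto
  · convert h1 using 1
    ext ω
    change M.X n ω ∈ B ↔ (M.X n ω ∈ B ∧ M.S n ω ≤ T)
    have : ¬ M.S n ω ≤ T → ¬ M.X n ω ∈ B := fun h => by rwa [hX ω h]
    tauto

theorem isLeast_filtration (M : MarkedPointProcess P K T) :
    IsLeast {𝓖 : Filtration ℝ≥0 mΩ | ∀ n, 1 ≤ n → ∃ h : IsStoppingTime 𝓖 (M.S n),
      Measurable[h.measurableSpace] (M.X n)} M.filtration := by
  refine ⟨fun n _ => ⟨M.isStoppingTime n, M.measurable_mark n⟩, fun 𝓖 h𝓖 t => ?_⟩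
  apply MeasurableSpace.generateFrom_le
  rintro E ⟨n, hn, s, hs, B, hB, rfl⟩
  obtain ⟨h, hX⟩ := h𝓖 n hn
  exact 𝓖.mono hs _ ((hX hB).2 s)

/-- The random counting measure `μ = ∑_{n ≥ 1, S n ≤ T} ε_{(S n, X n)}`. -/
def randomMeasure (M : MarkedPointProcess P K T) (ω : Ω) : Measure (ℝ≥0 × K) :=
  Measure.sum fun n : ℕ =>
    if M.S (n + 1) ω ≤ T then Measure.dirac ((M.S (n + 1) ω).untopD 0, M.X (n + 1) ω) else 0

/-- The random measure `dN` on the time axis of the univariate point process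
`N t = μ ([0, t] × K) = ∑_{n ≥ 1} 1_{S n ≤ t}`. -/
def jumpMeasure (M : MarkedPointProcess P K T) (ω : Ω) : Measure ℝ≥0 :=
  (M.randomMeasure ω).map Prod.fst

end MarkedPointProcess

open Classical in
/-- The Lebesgue-Stieltjes measure `da` on `(0, ∞)` of a nondecreasing right-continuous function
`a` on `[0, ∞)` (it is only used for such functions). -/
def pathMeasure (a : ℝ≥0 → ℝ) : Measure ℝ≥0 :=
  if h : Monotone a ∧ ∀ t, ContinuousWithinAt a (Set.Ici t) t then
    StieltjesFunction.measure ⟨a, h.1, h.2⟩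
  else 0

namespace MarkedPointProcess

variable {Ω : Type*} [mΩ : MeasurableSpace Ω] {P : Measure Ω} {K : Type*} [MeasurableSpace K]
  {T : ℝ≥0}

/-- `A` is (a version of) the predictable compensator of the univariate point process `N`, relative
to the filtration generated by the marked point process: `A` is predictable, almost all of its paths
are nondecreasing, càdlàg (left limits exist by monotonicity) and start at `0`, and
`E ∫ H dN = E ∫ H dA` for every nonnegative predictable `H`. Since `N` does not jump after `T`,
`A` is, up to indistinguishability, constant on `[T, ∞)`. -/
structure IsCompensator (M : MarkedPointProcess P K T) (A : ℝ≥0 → Ω → ℝ) : Prop where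
  predictable : IsStronglyPredictable M.filtration A
  zero : ∀ᵐ ω ∂P, A 0 ω = 0
  mono : ∀ᵐ ω ∂P, Monotone fun t => A t ω
  right_continuous : ∀ᵐ ω ∂P, ∀ t, ContinuousWithinAt (fun s => A s ω) (Set.Ici t) t
  lintegral_eq : ∀ H : ℝ≥0 × Ω → ℝ≥0∞, Measurable[M.filtration.predictable] H →
    ∫⁻ ω, ∫⁻ t, H (t, ω) ∂(M.jumpMeasure ω) ∂P
      = ∫⁻ ω, ∫⁻ t, H (t, ω) ∂(pathMeasure fun t => A t ω) ∂P

/-- The conditional probability `P (S (n + 1) > T | 𝓕_{S n})`. -/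
def condSurvival (M : MarkedPointProcess P K T) (n : ℕ) : Ω → ℝ :=
  P⟦{ω | (T : WithTop ℝ≥0) < M.S (n + 1) ω} | (M.isStoppingTime n).measurableSpace⟧

end MarkedPointProcess

end

/-! For `B ∈ 𝓕_{S n}`, test the compensator against the predictable process `H = 1_B 1_{(S n, S (n +
1) ∧ T]} e^A`. Its `dN` integral sees only the jump at `S (n + 1)`; its `dA` integral telescopes
because `A` is continuous and `e^a da = d(e^a)`. This gives `IsCompensator.setLIntegral_exp_add`.
Now let `B` be the event that the conditional survival probability is `≤ 0`. Almost surely on `B`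
the next jump occurs by `T`, so the two terms at `T ∧ S (n + 1)` agree; being finite, they cancel
and leave `E[1_B e^{A (T ∧ S n)}] = 0`. As the exponential is positive, `P B = 0`. -/

/-- A continuous nondecreasing function pushes its Lebesgue-Stieltjes measure forward to Lebesgue
measure. -/
theorem map_pathMeasure_restrict_Ioc {a : ℝ≥0 → ℝ} (hm : Monotone a) (hc : Continuous a)
    {u v : ℝ≥0} (huv : u ≤ v) :
    ((pathMeasure a).restrict (Set.Ioc u v)).map a = volume.restrict (Set.Ioc (a u) (a v)) := by
  have h : Monotone a ∧ ∀ t, ContinuousWithinAt a (Set.Ici t) t :=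
    ⟨hm, fun t => hc.continuousWithinAt⟩
  have hIoc : ∀ w, pathMeasure a (Set.Ioc u w) = ENNReal.ofReal (a w - a u) := by
    intro w
    rw [pathMeasure, dif_pos h]
    exact StieltjesFunction.measure_Ioc _ _ _
  have : IsFiniteMeasure ((pathMeasure a).restrict (Set.Ioc u v)) :=
    ⟨by rw [Measure.restrict_apply_univ, hIoc]; exact ENNReal.ofReal_lt_top⟩
  refine Measure.ext_of_Iic _ _ fun x => ?_
  rw [Measure.map_apply hc.measurable measurableSet_Iic,
    Measure.restrict_apply (hc.measurable measurableSet_Iic),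
    Measure.restrict_apply measurableSet_Iic]
  rcases lt_or_ge x (a u) with hx | hx
  · have h₁ : a ⁻¹' Set.Iic x ∩ Set.Ioc u v = ∅ := by
      ext t
      simp only [Set.mem_inter_iff, Set.mem_preimage, Set.mem_Iic, Set.mem_Ioc,
        Set.mem_empty_iff_false, iff_false]
      rintro ⟨h1, h2, -⟩
      exact absurd (hm h2.le) (by linarith)
    have h₂ : Set.Iic x ∩ Set.Ioc (a u) (a v) = ∅ := by
      ext t
      simp only [Set.mem_inter_iff, Set.mem_Iic, Set.mem_Ioc, Set.mem_empty_iff_false, iff_false]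
      rintro ⟨h1, h2, -⟩
      linarith
    simp [h₁, h₂]
  -- `w` is the last time in `[u, v]` with `a ≤ x`; taking the last one handles flat stretches of
  -- `a`.
  · have hcomp : IsCompact (Set.Icc u v ∩ a ⁻¹' Set.Iic x) :=
      isCompact_Icc.inter_right (isClosed_Iic.preimage hc)
    obtain ⟨w, ⟨⟨huw, hwv⟩, hwx⟩, hmax⟩ :=
      hcomp.exists_isGreatest ⟨u, ⟨le_rfl, huv⟩, hx⟩
    have hset : a ⁻¹' Set.Iic x ∩ Set.Ioc u v = Set.Ioc u w := by
      ext t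
      constructor
      · rintro ⟨h1, h2, h3⟩
        exact ⟨h2, hmax ⟨⟨h2.le, h3⟩, h1⟩⟩
      · rintro ⟨h1, h2⟩
        exact ⟨(hm h2).trans hwx, h1, h2.trans hwv⟩
    have haw : a w = min (a v) x := by
      refine le_antisymm (le_min (hm hwv) hwx) ?_
      -- Continuity enters here: the level `min (a v) x` is attained at some `z`, and `z ≤ w` by
      -- maximality of `w`.
      obtain ⟨z, hz, hzx⟩ := intermediate_value_Icc huv hc.continuousOn
        (show min (a v) x ∈ Set.Icc (a u) (a v) from ⟨le_min (hm huv) hx, min_le_left _ _⟩)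
      rw [← hzx]
      exact hm (hmax ⟨hz, show a z ≤ x from hzx ▸ min_le_right _ _⟩)
    rw [hset, hIoc, Set.inter_comm, Set.Ioc_inter_Iic, Real.volume_Ioc, haw]

/-- Change of variables `∫_{(u, v]} e^{a} da = e^{a v} - e^{a u}` for a continuous nondecreasing
function `a`. -/
theorem setLIntegral_exp_pathMeasure {a : ℝ≥0 → ℝ} (hm : Monotone a) (hc : Continuous a)
    {u v : ℝ≥0} (huv : u ≤ v) :
    ∫⁻ t in Set.Ioc u v, ENNReal.ofReal (Real.exp (a t)) ∂(pathMeasure a)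
      = ENNReal.ofReal (Real.exp (a v) - Real.exp (a u)) := by
  have hmeas : Measurable fun x : ℝ => ENNReal.ofReal (Real.exp x) := by fun_prop
  rw [← lintegral_map (f := fun x => ENNReal.ofReal (Real.exp x)) hmeas hc.measurable,
    map_pathMeasure_restrict_Ioc hm hc huv,
    ← ofReal_integral_eq_lintegral_ofReal
      (Real.continuous_exp.integrableOn_Ioc) (ae_of_all _ fun x => (Real.exp_pos x).le),
    ← intervalIntegral.integral_of_le (hm huv), integral_exp]

/-! ### Predictable sets and stochastic intervals -/

/-- The predictable σ-algebra is contained in the product σ-algebra. -/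
theorem MeasureTheory.Filtration.predictable_le_prod {Ω : Type*} [mΩ : MeasurableSpace Ω]
    (𝓕 : Filtration ℝ≥0 mΩ) : 𝓕.predictable ≤ (inferInstance : MeasurableSpace (ℝ≥0 × Ω)) :=
  measurableSpace_le_predictable_of_measurableSet
    (fun _ hs => (measurableSet_singleton _).prod (𝓕.le _ _ hs))
    (fun i _ hs => measurableSet_Ioi.prod (𝓕.le i _ hs))

/-- For `B ∈ 𝓕_τ` the stochastic interval `(τ, ∞)` restricted to `B` is predictable. -/
theorem MeasureTheory.IsStoppingTime.measurableSet_predictable_lt {Ω : Type*}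
    [mΩ : MeasurableSpace Ω] {𝓕 : Filtration ℝ≥0 mΩ} {τ : Ω → WithTop ℝ≥0}
    (hτ : IsStoppingTime 𝓕 τ) {B : Set Ω} (hB : MeasurableSet[hτ.measurableSpace] B) :
    MeasurableSet[𝓕.predictable] {p : ℝ≥0 × Ω | p.2 ∈ B ∧ τ p.2 < p.1} := by
  obtain ⟨D, hDc, hD⟩ := TopologicalSpace.exists_countable_dense ℝ≥0
  have heq : {p : ℝ≥0 × Ω | p.2 ∈ B ∧ τ p.2 < p.1}
      = ⋃ q ∈ D, Set.Ioi q ×ˢ (B ∩ {ω | τ ω ≤ q}) := by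
    ext ⟨t, ω⟩
    simp only [Set.mem_ofPred_eq, Set.mem_iUnion, Set.mem_prod, Set.mem_Ioi, Set.mem_inter_iff,
      exists_prop]
    constructor
    · rintro ⟨hω, hlt⟩
      lift τ ω to ℝ≥0 using hlt.ne_top with s hs
      obtain ⟨q, hqD, hsq, hqt⟩ := hD.exists_between (WithTop.coe_lt_coe.1 hlt)
      exact ⟨q, hqD, hqt, hω, WithTop.coe_le_coe.2 hsq.le⟩
    · rintro ⟨q, -, hqt, hω, hle⟩
      exact ⟨hω, hle.trans_lt (WithTop.coe_lt_coe.2 hqt)⟩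
  rw [heq]
  exact MeasurableSet.biUnion hDc fun q _ => measurableSet_predictable_Ioi_prod (hB.2 q)

namespace MarkedPointProcess

variable {Ω : Type*} [mΩ : MeasurableSpace Ω] {P : Measure Ω} {K : Type*} [MeasurableSpace K]
  {T : ℝ≥0}

/-! ### Interarrival intervals and truncated jump times -/

theorem monotone_S (M : MarkedPointProcess P K T) (ω : Ω) : Monotone fun n => M.S n ω :=
  monotone_nat_of_le_succ fun n => M.S_mono n ω

/-- The default `0` in `untopD` is never used: the guard `≤ T` makes the jump time finite. -/
theorem lintegral_jumpMeasure (M : MarkedPointProcess P K T) (ω : Ω) {f : ℝ≥0 → ℝ≥0∞}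
    (hf : Measurable f) :
    ∫⁻ t, f t ∂(M.jumpMeasure ω)
      = ∑' k, if M.S (k + 1) ω ≤ T then f ((M.S (k + 1) ω).untopD 0) else 0 := by
  rw [jumpMeasure, lintegral_map hf measurable_fst, randomMeasure, lintegral_sum_measure]
  refine tsum_congr fun k => ?_
  split_ifs
  · exact lintegral_dirac' _ (hf.comp measurable_fst)
  · simp

/-- The set `{(t, ω) | ω ∈ B, S n ω < t ≤ S (n + 1) ω, t ≤ T}`. -/
def interarrival (M : MarkedPointProcess P K T) (n : ℕ) (B : Set Ω) : Set (ℝ≥0 × Ω) :=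
  {p | p.2 ∈ B ∧ M.S n p.2 < p.1 ∧ (p.1 : WithTop ℝ≥0) ≤ M.S (n + 1) p.2 ∧ p.1 ≤ T}

theorem measurableSet_interarrival (M : MarkedPointProcess P K T) (n : ℕ) {B : Set Ω}
    (hB : MeasurableSet[(M.isStoppingTime n).measurableSpace] B) :
    MeasurableSet[M.filtration.predictable] (M.interarrival n B) := by
  have h₁ := (M.isStoppingTime n).measurableSet_predictable_lt hB
  have h₂ := (M.isStoppingTime (n + 1)).measurableSet_predictable_lt MeasurableSet.univ
  have h₃ : MeasurableSet[M.filtration.predictable] (Set.Ioi T ×ˢ (Set.univ : Set Ω)) :=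
    measurableSet_predictable_Ioi_prod MeasurableSet.univ
  convert (h₁.diff h₂).diff h₃ using 1
  ext ⟨t, ω⟩
  simp only [interarrival, Set.mem_ofPred_eq, Set.mem_sdiff, Set.mem_univ, true_and, not_lt,
    Set.mem_prod, Set.mem_Ioi, and_true]
  tauto

/-- The time `T ∧ S n`. -/
noncomputable def truncTime (M : MarkedPointProcess P K T) (n : ℕ) (ω : Ω) : ℝ≥0 :=
  (min (T : WithTop ℝ≥0) (M.S n ω)).untopA

theorem coe_truncTime (M : MarkedPointProcess P K T) (n : ℕ) (ω : Ω) :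
    (M.truncTime n ω : WithTop ℝ≥0) = min (T : WithTop ℝ≥0) (M.S n ω) := by
  have h : min (T : WithTop ℝ≥0) (M.S n ω) ≠ ⊤ :=
    ne_top_of_le_ne_top WithTop.coe_ne_top (min_le_left _ _)
  rw [truncTime, WithTop.untopA_eq_untop h, WithTop.coe_untop]

theorem truncTime_le (M : MarkedPointProcess P K T) (n : ℕ) (ω : Ω) : M.truncTime n ω ≤ T :=
  WithTop.coe_le_coe.1 ((M.coe_truncTime n ω).trans_le (min_le_left _ _))

theorem truncTime_mono (M : MarkedPointProcess P K T) (n : ℕ) (ω : Ω) :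
    M.truncTime n ω ≤ M.truncTime (n + 1) ω := by
  rw [← WithTop.coe_le_coe, coe_truncTime, coe_truncTime]
  exact min_le_min_left _ (M.S_mono n ω)

theorem measurable_truncTime (M : MarkedPointProcess P K T) (n : ℕ) :
    Measurable (M.truncTime n) :=
  (measurable_const.min (M.measurable_S n)).untopA

/-- Truncating both endpoints at `T` loses nothing: if `S n ≥ T`, both sides are empty. -/
theorem mk_mem_interarrival_iff (M : MarkedPointProcess P K T) (n : ℕ) {B : Set Ω} {ω : Ω}
    (hω : ω ∈ B) (t : ℝ≥0) :
    (t, ω) ∈ M.interarrival n B ↔ t ∈ Set.Ioc (M.truncTime n ω) (M.truncTime (n + 1) ω) := by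
  rw [Set.mem_Ioc, ← WithTop.coe_lt_coe, ← WithTop.coe_le_coe (α := ℝ≥0), coe_truncTime,
    coe_truncTime, le_min_iff, min_lt_iff, WithTop.coe_le_coe, WithTop.coe_lt_coe]
  simp only [interarrival, Set.mem_ofPred_eq, hω, true_and]
  constructor
  · rintro ⟨h1, h2, h3⟩
    exact ⟨Or.inr h1, h3, h2⟩
  · rintro ⟨h1 | h1, h3, h2⟩
    · exact absurd h1 h3.not_gt
    · exact ⟨h1, h2, h3⟩

theorem IsCompensator.measurable_uncurry {M : MarkedPointProcess P K T} {A : ℝ≥0 → Ω → ℝ}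
    (hA : M.IsCompensator A) : Measurable[M.filtration.predictable] (Function.uncurry A) :=
  StronglyMeasurable.measurable hA.predictable

theorem IsCompensator.measurable_truncTime {M : MarkedPointProcess P K T} {A : ℝ≥0 → Ω → ℝ}
    (hA : M.IsCompensator A) (n : ℕ) : Measurable fun ω => A (M.truncTime n ω) ω :=
  (hA.measurable_uncurry.mono M.filtration.predictable_le_prod le_rfl).comp
    ((M.measurable_truncTime n).prodMk measurable_id)

/-! ### Both integrals of the exponential test process -/

/-- The predictable process `1_B 1_{(S n, S (n + 1) ∧ T]} e^A`. -/
noncomputable def expOnInterarrival (M : MarkedPointProcess P K T) (A : ℝ≥0 → Ω → ℝ) (n : ℕ) (B : Set Ω) :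
    ℝ≥0 × Ω → ℝ≥0∞ :=
  (M.interarrival n B).indicator fun p => ENNReal.ofReal (Real.exp (A p.1 p.2))

theorem IsCompensator.measurable_expOnInterarrival {M : MarkedPointProcess P K T}
    {A : ℝ≥0 → Ω → ℝ} (hA : M.IsCompensator A) (n : ℕ) {B : Set Ω}
    (hB : MeasurableSet[(M.isStoppingTime n).measurableSpace] B) :
    Measurable[M.filtration.predictable] (M.expOnInterarrival A n B) :=
  Measurable.indicator
    (ENNReal.measurable_ofReal.comp (Real.measurable_exp.comp hA.measurable_uncurry))
    (M.measurableSet_interarrival n hB)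

theorem lintegral_expOnInterarrival_jumpMeasure {M : MarkedPointProcess P K T}
    {A : ℝ≥0 → Ω → ℝ} (hA : M.IsCompensator A) (n : ℕ) {B : Set Ω}
    (hB : MeasurableSet[(M.isStoppingTime n).measurableSpace] B) {ω : Ω}
    (hω : ∀ n, M.S n ω ≤ T → M.S n ω < M.S (n + 1) ω) :
    ∫⁻ t, M.expOnInterarrival A n B (t, ω) ∂(M.jumpMeasure ω)
      = (B ∩ {ω | M.S (n + 1) ω ≤ T}).indicator
          (fun ω => ENNReal.ofReal (Real.exp (A (M.truncTime (n + 1) ω) ω))) ω := by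
  have hmeas : Measurable fun t => M.expOnInterarrival A n B (t, ω) :=
    ((hA.measurable_expOnInterarrival n hB).mono M.filtration.predictable_le_prod le_rfl).comp
      measurable_prodMk_right
  -- Index `k` stands for the jump `S (k + 1)`, so only `k = n` can fall in `(S n, S (n + 1)]`:
  -- smaller `k` give `S (k + 1) ≤ S n`, larger ones `S (n + 1) ≤ S k < S (k + 1)`.
  rw [M.lintegral_jumpMeasure ω hmeas, tsum_eq_single n]
  · by_cases hS : M.S (n + 1) ω ≤ T
    · have htr : (M.S (n + 1) ω).untopD 0 = M.truncTime (n + 1) ω := by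
        have := M.coe_truncTime (n + 1) ω
        rw [min_eq_right hS] at this
        rw [← this]; rfl
      by_cases hωB : ω ∈ B
      · have hlt : M.truncTime n ω < M.truncTime (n + 1) ω := by
          have hn := (M.S_mono n ω).trans hS
          rw [← WithTop.coe_lt_coe, coe_truncTime, coe_truncTime, min_eq_right hS,
            min_eq_right hn]
          exact hω n hn
        rw [if_pos hS, htr, expOnInterarrival, Set.indicator_of_mem, Set.indicator_of_mem]
        · exact ⟨hωB, hS⟩
        · exact (M.mk_mem_interarrival_iff n hωB _).2 ⟨hlt, le_rfl⟩
      · rw [if_pos hS, expOnInterarrival, Set.indicator_of_notMem, Set.indicator_of_notMem]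
        · exact fun h => hωB h.1
        · exact fun h => hωB h.1
    · rw [if_neg hS, Set.indicator_of_notMem]
      exact fun h => hS h.2
  · intro k hk
    split_ifs with hS
    · refine Set.indicator_of_notMem ?_ _
      rintro ⟨-, h1, h2, -⟩
      have hcoe : (((M.S (k + 1) ω).untopD 0 : ℝ≥0) : WithTop ℝ≥0) = M.S (k + 1) ω := by
        lift M.S (k + 1) ω to ℝ≥0 using ne_top_of_le_ne_top WithTop.coe_ne_top hS with s
        rfl
      simp only [hcoe] at h1 h2
      rcases lt_or_gt_of_ne hk with hlt | hgt
      · exact absurd (M.monotone_S ω (Nat.succ_le_of_lt hlt)) h1.not_ge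
      · have hle : M.S (n + 1) ω ≤ M.S k ω := M.monotone_S ω (Nat.succ_le_of_lt hgt)
        have hk' := hω k ((M.S_mono k ω).trans hS)
        exact absurd (h2.trans hle) hk'.not_ge
    · rfl

theorem lintegral_expOnInterarrival_pathMeasure (M : MarkedPointProcess P K T)
    {A : ℝ≥0 → Ω → ℝ} (n : ℕ) {B : Set Ω} {ω : Ω} (hm : Monotone fun t => A t ω)
    (hc : Continuous fun t => A t ω) :
    ∫⁻ t, M.expOnInterarrival A n B (t, ω) ∂(pathMeasure fun t => A t ω)
      = B.indicator (fun ω => ENNReal.ofReal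
          (Real.exp (A (M.truncTime (n + 1) ω) ω) - Real.exp (A (M.truncTime n ω) ω))) ω := by
  by_cases hω : ω ∈ B
  · rw [Set.indicator_of_mem hω, ← setLIntegral_exp_pathMeasure hm hc (M.truncTime_mono n ω),
      ← lintegral_indicator measurableSet_Ioc]
    refine lintegral_congr fun t => ?_
    have hiff := M.mk_mem_interarrival_iff n hω t
    by_cases ht : t ∈ Set.Ioc (M.truncTime n ω) (M.truncTime (n + 1) ω)
    · rw [expOnInterarrival, Set.indicator_of_mem (hiff.2 ht), Set.indicator_of_mem ht]
    · rw [expOnInterarrival, Set.indicator_of_notMem (mt hiff.1 ht), Set.indicator_of_notMem ht]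
  · rw [Set.indicator_of_notMem hω]
    refine (lintegral_congr fun t => ?_).trans lintegral_zero
    exact Set.indicator_of_notMem (fun h => hω h.1) _

/-- For `B ∈ 𝓕_{S n}` and a continuous compensator `A`,
`E[1_B 1_{S (n + 1) ≤ T} e^{A (T ∧ S (n + 1))}] + E[1_B e^{A (T ∧ S n)}]
  = E[1_B e^{A (T ∧ S (n + 1))}]`. -/
theorem IsCompensator.setLIntegral_exp_add {M : MarkedPointProcess P K T} {A : ℝ≥0 → Ω → ℝ}
    (hA : M.IsCompensator A) (hc : ∀ᵐ ω ∂P, Continuous fun t => A t ω) (n : ℕ) {B : Set Ω}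
    (hB : MeasurableSet[(M.isStoppingTime n).measurableSpace] B) :
    ∫⁻ ω in B ∩ {ω | M.S (n + 1) ω ≤ T},
        ENNReal.ofReal (Real.exp (A (M.truncTime (n + 1) ω) ω)) ∂P
      + ∫⁻ ω in B, ENNReal.ofReal (Real.exp (A (M.truncTime n ω) ω)) ∂P
      = ∫⁻ ω in B, ENNReal.ofReal (Real.exp (A (M.truncTime (n + 1) ω) ω)) ∂P := by
  have hBm : MeasurableSet B := (M.isStoppingTime n).measurableSpace_le _ hB
  have hSm : MeasurableSet {ω | M.S (n + 1) ω ≤ T} := M.measurable_S _ measurableSet_Iic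
  have hmeas : Measurable fun ω => ENNReal.ofReal (Real.exp (A (M.truncTime n ω) ω)) :=
    ENNReal.measurable_ofReal.comp (Real.measurable_exp.comp (hA.measurable_truncTime n))
  have key : ∫⁻ ω in B ∩ {ω | M.S (n + 1) ω ≤ T},
        ENNReal.ofReal (Real.exp (A (M.truncTime (n + 1) ω) ω)) ∂P
      = ∫⁻ ω in B, ENNReal.ofReal
          (Real.exp (A (M.truncTime (n + 1) ω) ω) - Real.exp (A (M.truncTime n ω) ω)) ∂P := by
    rw [← lintegral_indicator (hBm.inter hSm), ← lintegral_indicator hBm]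
    calc _ = ∫⁻ ω, ∫⁻ t, M.expOnInterarrival A n B (t, ω) ∂(M.jumpMeasure ω) ∂P := by
          refine lintegral_congr_ae ?_
          filter_upwards [M.S_strict] with ω hω
          exact (lintegral_expOnInterarrival_jumpMeasure hA n hB hω).symm
      _ = _ := hA.lintegral_eq _ (hA.measurable_expOnInterarrival n hB)
      _ = _ := by
          refine lintegral_congr_ae ?_
          filter_upwards [hA.mono, hc] with ω hm hc
          exact M.lintegral_expOnInterarrival_pathMeasure n hm hc
  -- Adding the term at `S n` back, rather than splitting a difference, keeps the identity valid for
  -- infinite expectations.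
  rw [key, ← lintegral_add_right _ hmeas]
  refine lintegral_congr_ae (ae_restrict_of_ae ?_)
  filter_upwards [hA.mono] with ω hm
  have hle := Real.exp_le_exp.2 (hm (M.truncTime_mono n ω))
  rw [← ENNReal.ofReal_add (sub_nonneg.2 hle) (Real.exp_pos _).le, sub_add_cancel]

/-! ### Positivity of the conditional survival probability -/

theorem condSurvival_pos [IsProbabilityMeasure P] {M : MarkedPointProcess P K T}
    {A : ℝ≥0 → Ω → ℝ} (hA : M.IsCompensator A) (hc : ∀ᵐ ω ∂P, Continuous fun t => A t ω) (n : ℕ)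
    (hfin : ∫⁻ ω, ENNReal.ofReal (Real.exp (A (M.truncTime (n + 1) ω) ω)) ∂P < ∞) :
    ∀ᵐ ω ∂P, 0 < M.condSurvival n ω := by
  have hle : (M.isStoppingTime n).measurableSpace ≤ mΩ := (M.isStoppingTime n).measurableSpace_le
  set E : Set Ω := {ω | (T : WithTop ℝ≥0) < M.S (n + 1) ω}
  have hEm : MeasurableSet E := M.measurable_S _ measurableSet_Ioi
  set B : Set Ω := {ω | M.condSurvival n ω ≤ 0}
  have hB : MeasurableSet[(M.isStoppingTime n).measurableSpace] B := by
    have h : StronglyMeasurable[(M.isStoppingTime n).measurableSpace] (M.condSurvival n) :=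
      stronglyMeasurable_condExp
    exact h.measurable measurableSet_Iic
  have hBm : MeasurableSet B := hle _ hB
  -- Since `B ∈ 𝓕_{S n}`, `P (B ∩ E)` is the integral over `B` of the conditional probability, hence
  -- `≤ 0`.
  have hBE : P (B ∩ E) = 0 := by
    have h₁ : ∫ ω in B, M.condSurvival n ω ∂P = ∫ ω in B, E.indicator (fun _ => (1 : ℝ)) ω ∂P :=
      setIntegral_condExp hle ((integrable_const _).indicator hEm) hB
    have h₂ : ∫ ω in B, M.condSurvival n ω ∂P ≤ 0 := setIntegral_nonpos hBm fun ω hω => hω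
    rw [h₁, setIntegral_indicator hEm, setIntegral_const, smul_eq_mul, mul_one] at h₂
    exact (measureReal_eq_zero_iff).1 (le_antisymm h₂ measureReal_nonneg)
  have hset : (B ∩ {ω | M.S (n + 1) ω ≤ T} : Set Ω) =ᵐ[P] B := by
    have : ∀ᵐ ω ∂P, ω ∉ B ∩ E := measure_eq_zero_iff_ae_notMem.1 hBE
    filter_upwards [this] with ω hω
    refine propext ⟨fun h => h.1, fun h => ⟨h, ?_⟩⟩
    exact not_lt.1 fun hlt : (T : WithTop ℝ≥0) < M.S (n + 1) ω => hω ⟨h, hlt⟩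
  have hid := hA.setLIntegral_exp_add hc n hB
  rw [setLIntegral_congr hset] at hid
  -- The exponential moment serves only to make this term cancellable in `ℝ≥0∞`.
  have hne : ∫⁻ ω in B, ENNReal.ofReal (Real.exp (A (M.truncTime (n + 1) ω) ω)) ∂P ≠ ∞ :=
    ((setLIntegral_le_lintegral _ _).trans_lt hfin).ne
  have hzero : ∫⁻ ω in B, ENNReal.ofReal (Real.exp (A (M.truncTime n ω) ω)) ∂P = 0 :=
    (ENNReal.add_right_inj hne).1 (hid.trans (add_zero _).symm)
  have hmeas : Measurable fun ω => ENNReal.ofReal (Real.exp (A (M.truncTime n ω) ω)) :=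
    ENNReal.measurable_ofReal.comp (Real.measurable_exp.comp (hA.measurable_truncTime n))
  rw [setLIntegral_eq_zero_iff hBm hmeas] at hzero
  filter_upwards [hzero] with ω hω
  by_contra hneg
  exact (ENNReal.ofReal_pos.2 (Real.exp_pos _)).ne' (hω (not_lt.1 hneg))

end MarkedPointProcess

theorem lemma4p2 {Ω K : Type*} [MeasurableSpace Ω] [MeasurableSpace K]
    (P : Measure Ω) [IsProbabilityMeasure P] (T : ℝ≥0) (hT : 0 < T)
    (M : MarkedPointProcess P K T) (A : ℝ≥0 → Ω → ℝ) (hA : M.IsCompensator A)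
    (hA₁ : ∀ᵐ ω ∂P, Continuous fun t => A t ω) :
    (∀ n : ℕ,
      ∫⁻ ω, ENNReal.ofReal (Real.exp (stoppedProcess A (M.S (n + 1)) T ω)) ∂P < ∞ →
        ∀ᵐ ω ∂P, 0 < M.condSurvival n ω) ∧
    (∀ β : ℝ, 1 ≤ β →
      ∫⁻ ω, ENNReal.ofReal (Real.exp (β * A T ω)) ∂P < ∞ →
        ∀ n : ℕ, ∀ᵐ ω ∂P, 0 < M.condSurvival n ω) := by
  -- By definition, `stoppedProcess A (M.S (n + 1)) T` evaluates `A` at `truncTime (n + 1)`, so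
  -- `hfin` applies as it is.
  refine ⟨fun n hfin => MarkedPointProcess.condSurvival_pos hA hA₁ n hfin,
    fun β hβ hfin n => MarkedPointProcess.condSurvival_pos hA hA₁ n
      (lt_of_le_of_lt (lintegral_mono_ae ?_) hfin)⟩
  filter_upwards [hA.mono, hA.zero] with ω hm h0
  have h₁ : A (M.truncTime (n + 1) ω) ω ≤ A T ω := hm (M.truncTime_le (n + 1) ω)
  have h₂ : 0 ≤ A T ω := h0 ▸ hm (zero_le (a := T))
  -- `A (T ∧ S (n + 1)) ≤ A T ≤ β * A T`, the latter from `A T ≥ 0` and `β ≥ 1`.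
  exact ENNReal.ofReal_le_ofReal (Real.exp_le_exp.2 (by nlinarith))
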